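/- Let $(X,d)$ be a Polish metric space and let $m=(m_x)_{x\in X}$ be a random walk on $X$: a family of Borel probability measures depending measurably on $x$, each with finite first moment. Let $\nu$ be a Borel probability measure on $X$ that is reversible for $m$, i.e. $dm_x(y)\,d\nu(x)=dm_y(x)\,d\nu(y)$, and assume that $[X,d,m]$ is $m$-connected: $\int_A m_x(B)\,d\nu(x)>0$ for all $\nu$-measurable $A,B$ with $\nu(A),\nu(B)>0$ and $A\cup B=X$. For $\nu$-measurable $E\subset X$ put $P_m(E)=\int_E m_x(X\setminus E)\,d\nu(x)$ and, if $\nu(E)>0$, $\lambda^m_E=P_m(E)/\nu(E)$. Let $$h_m(X)=\inf\Big\{\frac{P_m(D)}{\min\{\nu(D),\nu(X\setminus D)\}} : D\subset X\ \nu\text{-measurable},\ 0<\nu(D)<1\Big\}.$$ A $\nu$-measurable set $\Omega$ with $0<\nu(\Omega)<1$ is *$m$-calibrable* if $\lambda^m_\Omega=\inf\{\lambda^m_E : E\subset\Omega\ \nu\text{-measurable},\ \nu(E)>0\}$. For $u\in L^2(X,\nu)$ let $\mathcal F_m(u)=\frac12\int_X\int_X|u(y)-u(x)|\,dm_x(y)\,d\nu(x)$,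 and let $\partial\mathcal F_m(u)\subset L^2(X,\nu)$ be its subdifferential; the $1$-Laplacian is $\Delta_1^m=-\partial\mathcal F_m$. A pair $(\lambda,u)\in\mathbb R\times L^2(X,\nu)$ is an *$m$-eigenpair* of $\Delta^m_1$ (with $m$-eigenvalue $\lambda$ and eigenvector $u$) if $\|u\|_{L^1(X,\nu)}=1$ and $\lambda\xi\in\partial\mathcal F_m(u)$ for some function $\xi$ with $\xi(x)\in\mathrm{sign}(u(x))$ for every $x\in X$, where $\mathrm{sign}(r)=\{1\}$ if $r>0$, $\{-1\}$ if $r<0$, and $[-1,1]$ if $r=0$. Write $E_0(u)=\{x\in X: u(x)>0\}$. **Corollary.** Suppose that $h_m(X)$ is a positive (real) $m$-eigenvalue of $\Delta_1^m$. Then, for any eigenvector $u$ associated to $h_m(X)$ with $\nu(E_0(u))>0$, $$\Big(h_m(X),\ \tfrac{1}{\nu(E_0(u))}\chi_{E_0(u)}\Big)\ \text{ is an $m$-eigenpair of } \Delta_1^m,\qquad \nu(E_0(u))\le\tfrac12,\qquad h_m(X)=\lambda^m_{E_0(u)}.$$ Moreover, both $E_0(u)$ and $X\setminus E_0(u)$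 are $m$-calibrable. In particular, $\{E_0(u),X\setminus E_0(u)\}$ is an optimal Cheeger cut, i.e. $D=E_0(u)$ attains the infimum defining $h_m(X)$. -/

import Mathlib

open MeasureTheory ProbabilityTheory
open scoped ENNReal

noncomputable section

namespace RandomWalk

variable {X : Type*} [MeasurableSpace X]

/-! A random walk on `X` is a Markov kernel `m : Kernel X X`, with `m x` the law of the jump from `x`.
Sets that are measurable for the completion of `ν` are Mathlib's `NullMeasurableSet`s, and elements of
`L²(X, ν)` are represented by functions `u` with `MemLp u 2 ν`. -/

/-- Each jump law has a finite first moment. -/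
def HasFiniteFirstMoment {X : Type*} [PseudoEMetricSpace X] [MeasurableSpace X]
    (m : Kernel X X) : Prop :=
  ∀ z x : X, ∫⁻ y, edist z y ∂(m x) < ∞

/-- The `m`-interaction `L_m(A, B) = ∫_A ∫_B dm_x(y) dν(x)`. -/
def interaction (m : Kernel X X) (ν : Measure X) (A B : Set X) : ℝ≥0∞ :=
  ∫⁻ x in A, m x B ∂ν

/-- `m`-connectedness: two non-null sets that cover `X` always interact. -/
def IsMConnected (m : Kernel X X) (ν : Measure X) : Prop :=
  ∀ A B : Set X, NullMeasurableSet A ν → NullMeasurableSet B ν → 0 < ν A → 0 < ν B →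
    A ∪ B = Set.univ → 0 < interaction m ν A B

/-- The `m`-perimeter `P_m(E) = L_m(E, X ∖ E)`. -/
def perimeter (m : Kernel X X) (ν : Measure X) (E : Set X) : ℝ≥0∞ :=
  interaction m ν E Eᶜ

/-- `λ^m_Ω = P_m(Ω) / ν(Ω)`. -/
def perimeterRatio (m : Kernel X X) (ν : Measure X) (Ω : Set X) : ℝ≥0∞ :=
  perimeter m ν Ω / ν Ω

/-- The `m`-Cheeger constant `h_1^m(Ω)` of a set `Ω`. -/
def setCheegerConstant (m : Kernel X X) (ν : Measure X) (Ω : Set X) : ℝ≥0∞ :=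
  ⨅ (E : Set X) (_ : E ⊆ Ω) (_ : NullMeasurableSet E ν) (_ : 0 < ν E), perimeterRatio m ν E

/-- `E` is an `m`-Cheeger set of `Ω`: it attains the infimum that defines `h_1^m(Ω)`. -/
def IsCheegerSet (m : Kernel X X) (ν : Measure X) (E Ω : Set X) : Prop :=
  E ⊆ Ω ∧ NullMeasurableSet E ν ∧ 0 < ν E ∧ setCheegerConstant m ν Ω = perimeterRatio m ν E

/-- `Ω`, with `0 < ν(Ω) < ν(X)`, is `m`-calibrable: it is an `m`-Cheeger set of itself. -/
def IsCalibrable (m : Kernel X X) (ν : Measure X) (Ω : Set X) : Prop :=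
  0 < ν Ω ∧ ν Ω < ν Set.univ ∧ IsCheegerSet m ν Ω Ω

/-- The Cheeger cut value `P_m(D) / min {ν(D), ν(X ∖ D)}` of the partition `{D, X ∖ D}`. -/
def cutValue (m : Kernel X X) (ν : Measure X) (D : Set X) : ℝ≥0∞ :=
  perimeter m ν D / min (ν D) (ν Dᶜ)

/-- The global `m`-Cheeger constant `h_m(X)` (for a probability measure `ν`); it is `∞` when there
is no set `D` with `0 < ν(D) < 1`. -/
def cheegerConstant (m : Kernel X X) (ν : Measure X) : ℝ≥0∞ :=
  ⨅ (D : Set X) (_ : NullMeasurableSet D ν) (_ : 0 < ν D) (_ : ν D < 1), cutValue m ν D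

/-- `{D, X ∖ D}` is an optimal Cheeger cut: `D` attains the infimum that defines `h_m(X)`. -/
def IsOptimalCheegerCut (m : Kernel X X) (ν : Measure X) (D : Set X) : Prop :=
  NullMeasurableSet D ν ∧ 0 < ν D ∧ ν D < 1 ∧ cheegerConstant m ν = cutValue m ν D

/-- The `m`-total variation `TV_m(u) = 1/2 ∫∫ |u(y) - u(x)| dm_x(y) dν(x)`; for measurable `u` it
is finite exactly when `u ∈ BV_m(X, ν)`. -/
def totalVariation (m : Kernel X X) (ν : Measure X) (u : X → ℝ) : ℝ≥0∞ :=
  (1 / 2) * ∫⁻ x, ∫⁻ y, ENNReal.ofReal |u y - u x| ∂(m x) ∂ν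

/-- The functional `F_m` on `L²(X, ν)`: `TV_m` on `L² ∩ BV_m`, and `+∞` on the rest of `L²`. -/
def energy (m : Kernel X X) (ν : Measure X) (u : X → ℝ) : EReal :=
  (totalVariation m ν u : EReal)

/-- The subdifferential `∂F_m(u)` in the Hilbert space `L²(X, ν)`. -/
def energySubdifferential (m : Kernel X X) (ν : Measure X) (u : X → ℝ) : Set (X → ℝ) :=
  {v | MemLp u 2 ν ∧ MemLp v 2 ν ∧ ∀ w : X → ℝ, MemLp w 2 ν →
    energy m ν u + ((∫ x, v x * (w x - u x) ∂ν : ℝ) : EReal) ≤ energy m ν w}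

/-- The (multivalued) `1`-Laplacian: `v ∈ Δ_1^m u` iff `-v ∈ ∂F_m(u)`. -/
def oneLaplacian (m : Kernel X X) (ν : Measure X) (u : X → ℝ) : Set (X → ℝ) :=
  {v | -v ∈ energySubdifferential m ν u}

/-- The multivalued sign function. -/
def multiSign (r : ℝ) : Set ℝ :=
  if 0 < r then {1} else if r < 0 then {-1} else Set.Icc (-1) 1

/-- `(lam, u)` is an `m`-eigenpair of the `1`-Laplacian: `u ∈ L²`, `‖u‖_{L¹} = 1`, and
`-lam ξ ∈ Δ_1^m u` for some `ξ ∈ sign(u)`. -/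
def IsEigenpair (m : Kernel X X) (ν : Measure X) (lam : ℝ) (u : X → ℝ) : Prop :=
  MemLp u 2 ν ∧ eLpNorm u 1 ν = 1 ∧
    ∃ ξ : X → ℝ, (∀ x, ξ x ∈ multiSign (u x)) ∧ -(lam • ξ) ∈ oneLaplacian m ν u

/-- The superlevel set `E_t(u) = {x | u(x) > t}`. -/
def superlevel (t : ℝ) (u : X → ℝ) : Set X :=
  {x | t < u x}

/-- The normalized characteristic function `χ_E / ν(E)`. -/
def normalizedIndicator (ν : Measure X) (E : Set X) : X → ℝ :=
  E.indicator fun _ => 1 / ν.real E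

end RandomWalk

end

namespace RandomWalk

/-! ### Total variation, perimeter and the subdifferential. -/

section TotalVariation

variable {X : Type*} [MeasurableSpace X] {m : Kernel X X} {ν : Measure X}

/-! Write `h` for the Cheeger constant and `E = {u > 0}`. The energy is positively 1-homogeneous, so
`v` is a subgradient at `u` iff `∫ v w ≤ TV(w)` for every `w` in L², with equality at `w = u`
(`mem_energySubdifferential_iff`). Clamping to `[0, 1]` splits the total variation additively, so
equality at `u` passes to the clamp (`totalVariation_unitClamp_eq`). Apply this to `n u`: the clamps
converge to `χ_E`, and Fatou's lemma gives equality at `χ_E` for `v = h ξ`. Since `ξ = 1` on `E`,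
this equality reads `P(E) = h ν(E)`.

Testing against constants gives `∫ ξ = 0`, hence `ν(E) ≤ 1/2`. The ratio of `E` is therefore its cut
value, so the cut is optimal. Calibrability of `E` and of its complement follows by comparing their
subsets with `h`. -/

theorem ae_ae_of_invariant (hinv : m.Invariant ν) {p : X → Prop} (hp : ∀ᵐ y ∂ν, p y) :
    ∀ᵐ x ∂ν, ∀ᵐ y ∂m x, p y := by
  refine Measure.ae_ae_of_ae_comp (μ := ν) (κ := m) ?_
  rw [hinv.def]
  exact hp

theorem totalVariation_congr (hinv : m.Invariant ν) {u v : X → ℝ} (h : u =ᵐ[ν] v) :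
    totalVariation m ν u = totalVariation m ν v := by
  unfold totalVariation
  congr 1
  refine lintegral_congr_ae ?_
  filter_upwards [h, ae_ae_of_invariant hinv h] with x hx hy
  refine lintegral_congr_ae ?_
  filter_upwards [hy] with y hy
  rw [hx, hy]

theorem totalVariation_const (c : ℝ) : totalVariation m ν (fun _ => c) = 0 := by
  simp [totalVariation]

theorem interaction_congr (hinv : m.Invariant ν) {A B A' B' : Set X} (hA : A =ᵐ[ν] A')
    (hB : B =ᵐ[ν] B') : interaction m ν A B = interaction m ν A' B' := by
  unfold interaction
  rw [setLIntegral_congr hA]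
  refine lintegral_congr_ae (ae_restrict_of_ae ?_)
  filter_upwards [ae_ae_of_invariant hinv hB] with x hx
  exact measure_congr hx

variable [IsMarkovKernel m]

theorem perimeter_compl (hrev : m.IsReversible ν) {E : Set X} (hE : NullMeasurableSet E ν) :
    perimeter m ν Eᶜ = perimeter m ν E := by
  have hae : E =ᵐ[ν] toMeasurable ν E := hE.toMeasurable_ae_eq.symm
  have hT := measurableSet_toMeasurable ν E
  rw [perimeter, perimeter, compl_compl, interaction_congr hrev.invariant hae.compl hae,
    interaction_congr hrev.invariant hae hae.compl]
  exact hrev hT.compl hT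

/-- Jumps out of `E` and jumps into `E` each contribute one interaction; reversibility makes the two
equal, which absorbs the factor 1/2. -/
theorem totalVariation_indicator (hrev : m.IsReversible ν) {E : Set X}
    (hE : NullMeasurableSet E ν) :
    totalVariation m ν (E.indicator fun _ => 1) = perimeter m ν E := by
  have hinv := hrev.invariant
  wlog hmeas : MeasurableSet E generalizing E
  · have hae : E =ᵐ[ν] toMeasurable ν E := hE.toMeasurable_ae_eq.symm
    have hT := measurableSet_toMeasurable ν E
    rw [totalVariation_congr hinv (indicator_ae_eq_of_ae_eq_set hae), this hT.nullMeasurableSet hT]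
    exact (interaction_congr hinv hae hae.compl).symm
  have hin : ∀ x, ∫⁻ y, ENNReal.ofReal
        |E.indicator (fun _ => (1 : ℝ)) y - E.indicator (fun _ => (1 : ℝ)) x| ∂(m x)
      = E.indicator (fun x => m x Eᶜ) x + Eᶜ.indicator (fun x => m x E) x := by
    intro x
    by_cases hx : x ∈ E
    · have : ∀ y, ENNReal.ofReal |E.indicator (fun _ => (1 : ℝ)) y -
          E.indicator (fun _ => (1 : ℝ)) x| = Eᶜ.indicator (fun _ => 1) y := by
        intro y
        by_cases hy : y ∈ E <;> simp [hx, hy]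
      simp_rw [this]
      simp [hx, lintegral_indicator hmeas.compl]
    · have : ∀ y, ENNReal.ofReal |E.indicator (fun _ => (1 : ℝ)) y -
          E.indicator (fun _ => (1 : ℝ)) x| = E.indicator (fun _ => 1) y := by
        intro y
        by_cases hy : y ∈ E <;> simp [hx, hy]
      simp_rw [this]
      simp [hx, lintegral_indicator hmeas]
  have hsymm := perimeter_compl hrev hE
  unfold totalVariation
  simp_rw [hin]
  rw [lintegral_add_left ((m.measurable_coe hmeas.compl).indicator hmeas),
    lintegral_indicator hmeas, lintegral_indicator hmeas.compl]
  have h2 : ∫⁻ x in Eᶜ, m x E ∂ν = perimeter m ν E := by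
    rw [← hsymm, perimeter, interaction, compl_compl]
  rw [h2]
  change 1 / 2 * (perimeter m ν E + perimeter m ν E) = _
  rw [← two_mul, ← mul_assoc, one_div, ENNReal.inv_mul_cancel (by simp) (by simp), one_mul]

variable [IsProbabilityMeasure ν]

/-- By invariance the second marginal of `ν ⊗ₘ m` is again `ν`, so changing `u` on a null set does
not affect the double integral. -/
theorem ae_compProd_snd (hinv : m.Invariant ν) {p : X → Prop} (hp : ∀ᵐ y ∂ν, p y) :
    ∀ᵐ z ∂(ν ⊗ₘ m), p z.2 := by
  have h : Measure.map Prod.snd (ν ⊗ₘ m) = ν := by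
    have := Measure.snd_compProd ν m
    rw [hinv.def] at this
    exact this
  rw [← h] at hp
  exact ae_of_ae_map measurable_snd.aemeasurable hp

theorem ae_compProd_fst {p : X → Prop} (hp : ∀ᵐ y ∂ν, p y) : ∀ᵐ z ∂(ν ⊗ₘ m), p z.1 := by
  have h : Measure.map Prod.fst (ν ⊗ₘ m) = ν := Measure.fst_compProd ν m
  rw [← h] at hp
  exact ae_of_ae_map measurable_fst.aemeasurable hp

theorem ae_compProd_diff_eq (hinv : m.Invariant ν) {u v : X → ℝ} (h : u =ᵐ[ν] v) :
    (fun z : X × X => ENNReal.ofReal |u z.2 - u z.1|) =ᵐ[ν ⊗ₘ m]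
      fun z => ENNReal.ofReal |v z.2 - v z.1| := by
  filter_upwards [ae_compProd_fst h, ae_compProd_snd hinv h] with z h1 h2
  rw [h1, h2]

theorem aemeasurable_diff (hinv : m.Invariant ν) {u : X → ℝ} (hu : AEMeasurable u ν) :
    AEMeasurable (fun z : X × X => ENNReal.ofReal |u z.2 - u z.1|) (ν ⊗ₘ m) := by
  have hmk := hu.measurable_mk
  have h : Measurable fun z : X × X => ENNReal.ofReal |hu.mk u z.2 - hu.mk u z.1| := by
    fun_prop
  exact ⟨_, h, ae_compProd_diff_eq hinv hu.ae_eq_mk⟩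

theorem totalVariation_eq_lintegral_compProd (hinv : m.Invariant ν) {u : X → ℝ}
    (hu : AEMeasurable u ν) :
    totalVariation m ν u
      = (1 / 2) * ∫⁻ z, ENNReal.ofReal |u z.2 - u z.1| ∂(ν ⊗ₘ m) := by
  have hmk := hu.measurable_mk
  rw [totalVariation_congr hinv hu.ae_eq_mk,
    lintegral_congr_ae (ae_compProd_diff_eq hinv hu.ae_eq_mk),
    Measure.lintegral_compProd (by fun_prop)]
  rfl

theorem totalVariation_eq_add (hinv : m.Invariant ν) {u v w : X → ℝ} (hu : AEMeasurable u ν)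
    (hv : AEMeasurable v ν) (hw : AEMeasurable w ν)
    (h : ∀ x y, |w y - w x| = |u y - u x| + |v y - v x|) :
    totalVariation m ν w = totalVariation m ν u + totalVariation m ν v := by
  rw [totalVariation_eq_lintegral_compProd hinv hu, totalVariation_eq_lintegral_compProd hinv hv,
    totalVariation_eq_lintegral_compProd hinv hw, ← mul_add,
    ← lintegral_add_left' (aemeasurable_diff hinv hu)]
  simp_rw [h, ENNReal.ofReal_add (abs_nonneg _) (abs_nonneg _)]

theorem totalVariation_const_mul (hinv : m.Invariant ν) {u : X → ℝ} (hu : AEMeasurable u ν)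
    (c : ℝ) :
    totalVariation m ν (fun x => c * u x) = ENNReal.ofReal |c| * totalVariation m ν u := by
  rw [totalVariation_eq_lintegral_compProd hinv hu,
    totalVariation_eq_lintegral_compProd hinv (hu.const_mul c), mul_left_comm,
    ← lintegral_const_mul' _ _ ENNReal.ofReal_ne_top]
  simp_rw [← ENNReal.ofReal_mul (abs_nonneg c), ← abs_mul, mul_sub]

/-- Lower semicontinuity of the total variation, by Fatou's lemma on `ν ⊗ₘ m`. -/
theorem totalVariation_le_of_tendsto (hinv : m.Invariant ν) {f : ℕ → X → ℝ} {g : X → ℝ}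
    (hf : ∀ n, AEMeasurable (f n) ν) (hg : AEMeasurable g ν)
    (hfg : ∀ x, Filter.Tendsto (fun n => f n x) Filter.atTop (nhds (g x))) {C : ℝ≥0∞}
    (hC : ∀ n, totalVariation m ν (f n) ≤ C) : totalVariation m ν g ≤ C := by
  have hlim : ∀ z : X × X, ENNReal.ofReal |g z.2 - g z.1|
      = Filter.liminf (fun n => ENNReal.ofReal |f n z.2 - f n z.1|) Filter.atTop := fun z =>
    (ENNReal.tendsto_ofReal ((hfg z.2).sub (hfg z.1)).abs).liminf_eq.symm
  have hC' : ∀ n, ∫⁻ z, ENNReal.ofReal |f n z.2 - f n z.1| ∂(ν ⊗ₘ m) ≤ 2 * C := fun n => by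
    have h := hC n
    rw [totalVariation_eq_lintegral_compProd hinv (hf n)] at h
    calc _ = 2 * (1 / 2 * ∫⁻ z, ENNReal.ofReal |f n z.2 - f n z.1| ∂(ν ⊗ₘ m)) := by
          rw [← mul_assoc, one_div, ENNReal.mul_inv_cancel (by simp) (by simp), one_mul]
      _ ≤ _ := by gcongr
  rw [totalVariation_eq_lintegral_compProd hinv hg]
  simp_rw [hlim]
  calc _ ≤ 1 / 2 * Filter.liminf
            (fun n => ∫⁻ z, ENNReal.ofReal |f n z.2 - f n z.1| ∂(ν ⊗ₘ m)) Filter.atTop := by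
        gcongr
        exact lintegral_liminf_le' fun n => aemeasurable_diff hinv (hf n)
    _ ≤ 1 / 2 * (2 * C) := by
        gcongr
        exact Filter.liminf_le_of_le (by isBoundedDefault) fun b hb => by
          obtain ⟨n, hn⟩ := hb.exists
          exact hn.trans (hC' n)
    _ = C := by
        rw [← mul_assoc, one_div, ENNReal.inv_mul_cancel (by simp) (by simp), one_mul]

theorem coe_ennreal_add_coe_le_iff {a b : ℝ≥0∞} {r : ℝ} (ha : a ≠ ∞) (hb : b ≠ ∞) :
    (a : EReal) + (r : EReal) ≤ (b : EReal) ↔ a.toReal + r ≤ b.toReal := by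
  rw [← EReal.coe_ennreal_toReal ha, ← EReal.coe_ennreal_toReal hb]
  norm_cast

/-- Homogeneity gives an Euler relation: the competitors `0` and `2 u` force `TV(u) = ∫ v u`, and
the subgradient inequality then loses its terms in `u`. -/
theorem mem_energySubdifferential_iff (hinv : m.Invariant ν) {u v : X → ℝ} :
    v ∈ energySubdifferential m ν u ↔ MemLp u 2 ν ∧ MemLp v 2 ν ∧
      (∀ w : X → ℝ, MemLp w 2 ν → ENNReal.ofReal (∫ x, v x * w x ∂ν) ≤ totalVariation m ν w) ∧
      0 ≤ ∫ x, v x * u x ∂ν ∧ totalVariation m ν u = ENNReal.ofReal (∫ x, v x * u x ∂ν) := by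
  have hsub : ∀ {w : X → ℝ}, MemLp v 2 ν → MemLp u 2 ν → MemLp w 2 ν →
      ∫ x, v x * (w x - u x) ∂ν = ∫ x, v x * w x ∂ν - ∫ x, v x * u x ∂ν := by
    intro w hv hu hw
    simp_rw [mul_sub]
    exact integral_sub (hv.integrable_mul hw) (hv.integrable_mul hu)
  constructor
  · rintro ⟨hu, hv, H⟩
    have hzero := H (fun _ => 0) (memLp_const 0)
    have htwo := H (fun x => 2 * u x) (hu.const_mul 2)
    rw [hsub hv hu (memLp_const 0)] at hzero
    rw [hsub hv hu (hu.const_mul 2)] at htwo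
    unfold energy at hzero htwo
    rw [totalVariation_const] at hzero
    rw [totalVariation_const_mul hinv hu.aestronglyMeasurable.aemeasurable] at htwo
    -- The competitor `0` has zero energy, so a subgradient exists only where the energy is finite.
    have htop : totalVariation m ν u ≠ ∞ := by
      intro h
      rw [h, EReal.coe_ennreal_top, EReal.top_add_coe] at hzero
      simp at hzero
    rw [coe_ennreal_add_coe_le_iff htop (by simp)] at hzero
    rw [coe_ennreal_add_coe_le_iff htop (ENNReal.mul_ne_top (by simp) htop)] at htwo
    simp only [mul_left_comm _ (2 : ℝ), integral_const_mul, ENNReal.toReal_mul, abs_two, mul_zero,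
      integral_zero, ENNReal.toReal_zero, ENNReal.toReal_ofReal zero_le_two] at hzero htwo
    have heq : (totalVariation m ν u).toReal = ∫ x, v x * u x ∂ν := by linarith
    refine ⟨hu, hv, fun w hw => ?_, heq ▸ ENNReal.toReal_nonneg, ?_⟩
    · rcases eq_or_ne (totalVariation m ν w) ∞ with h | h
      · simp [h]
      have hw' := H w hw
      rw [hsub hv hu hw] at hw'
      unfold energy at hw'
      rw [coe_ennreal_add_coe_le_iff htop h] at hw'
      exact ENNReal.ofReal_le_of_le_toReal (by linarith)
    · rw [← heq, ENNReal.ofReal_toReal htop]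
  · rintro ⟨hu, hv, H, h0, heq⟩
    refine ⟨hu, hv, fun w hw => ?_⟩
    unfold energy
    rcases eq_or_ne (totalVariation m ν w) ∞ with h | h
    · simp [h]
    rw [hsub hv hu hw, coe_ennreal_add_coe_le_iff (by simp [heq]) h, heq,
      ENNReal.toReal_ofReal h0]
    have := (ENNReal.ofReal_le_iff_le_toReal h).1 (H w hw)
    linarith

end TotalVariation

/-! ### Calibrability and the Cheeger inequality. -/

section Cheeger

variable {X : Type*} [MeasurableSpace X] {m : Kernel X X} {ν : Measure X}

theorem isCalibrable_iff {Ω : Set X} (hΩ : NullMeasurableSet Ω ν) (h0 : 0 < ν Ω)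
    (h1 : ν Ω < ν Set.univ) :
    IsCalibrable m ν Ω ↔ ∀ E ⊆ Ω, NullMeasurableSet E ν → 0 < ν E →
      perimeterRatio m ν Ω ≤ perimeterRatio m ν E := by
  unfold IsCalibrable IsCheegerSet setCheegerConstant
  constructor
  · rintro ⟨-, -, -, -, -, h⟩ E hE hEm hE0
    rw [← h]
    exact iInf_le_of_le E (iInf_le_of_le hE (iInf_le_of_le hEm (iInf_le _ hE0)))
  · intro h
    refine ⟨h0, h1, subset_rfl, hΩ, h0, le_antisymm ?_ ?_⟩
    · exact iInf_le_of_le Ω (iInf_le_of_le subset_rfl (iInf_le_of_le hΩ (iInf_le _ h0)))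
    · exact le_iInf fun E => le_iInf fun hE => le_iInf fun hEm => le_iInf fun hE0 => h E hE hEm hE0

/-- The product form also covers null and full sets, where the minimum vanishes. -/
theorem cheegerConstant_mul_le_perimeter [IsProbabilityMeasure ν] {D : Set X}
    (hD : NullMeasurableSet D ν) : cheegerConstant m ν * min (ν D) (ν Dᶜ) ≤ perimeter m ν D := by
  rcases eq_or_ne (min (ν D) (ν Dᶜ)) 0 with h | h
  · simp [h]
  have hD0 : ν D ≠ 0 := fun h' => h (by simp [h'])
  have hD1 : ν Dᶜ ≠ 0 := fun h' => h (by simp [h'])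
  refine ENNReal.mul_le_of_le_div ?_
  refine iInf_le_of_le D (iInf_le_of_le hD (iInf_le_of_le (pos_iff_ne_zero.2 hD0) (iInf_le _ ?_)))
  exact lt_of_le_of_ne prob_le_one fun h' => hD1 ((prob_compl_eq_zero_iff₀ hD).2 h')

end Cheeger

/-! ### Truncation, passage to the positivity set, and the median property. -/

section Eigenpair

variable {X : Type*} [MeasurableSpace X] {m : Kernel X X} {ν : Measure X}

theorem multiSign_subset_Icc (r : ℝ) : multiSign r ⊆ Set.Icc (-1) 1 := by
  unfold multiSign
  split_ifs <;> simp

theorem eq_one_of_mem_multiSign {r s : ℝ} (hr : 0 < r) (hs : s ∈ multiSign r) : s = 1 := by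
  simpa [multiSign, hr] using hs

/-- The truncation of a real number to the unit interval. -/
def unitClamp (r : ℝ) : ℝ :=
  min (max r 0) 1

theorem unitClamp_nonneg (r : ℝ) : 0 ≤ unitClamp r :=
  le_min (le_max_right _ _) zero_le_one

theorem unitClamp_le_one (r : ℝ) : unitClamp r ≤ 1 :=
  min_le_right _ _

theorem unitClamp_of_nonpos {r : ℝ} (hr : r ≤ 0) : unitClamp r = 0 := by
  simp [unitClamp, hr]

theorem measurable_unitClamp : Measurable unitClamp := by
  unfold unitClamp
  fun_prop

/-- Both `r ↦ unitClamp r` and `r ↦ r - unitClamp r` are nondecreasing, so their increments have the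
same sign and do not cancel. -/
theorem abs_sub_eq_unitClamp_add (a b : ℝ) :
    |b - a| = |unitClamp b - unitClamp a| + |(b - unitClamp b) - (a - unitClamp a)| := by
  have key : ∀ a b : ℝ, a ≤ b →
      unitClamp a ≤ unitClamp b ∧ a - unitClamp a ≤ b - unitClamp b := by
    intro a b h
    unfold unitClamp
    constructor <;> grind
  rcases le_total a b with h | h
  · obtain ⟨h1, h2⟩ := key a b h
    rw [abs_of_nonneg (sub_nonneg.2 h), abs_of_nonneg (sub_nonneg.2 h1),
      abs_of_nonneg (sub_nonneg.2 h2)]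
    ring
  · obtain ⟨h1, h2⟩ := key b a h
    rw [abs_of_nonpos (sub_nonpos.2 h), abs_of_nonpos (sub_nonpos.2 h1),
      abs_of_nonpos (sub_nonpos.2 h2)]
    ring

theorem tendsto_unitClamp_nat_mul (r : ℝ) :
    Filter.Tendsto (fun n : ℕ => unitClamp (n * r)) Filter.atTop
      (nhds ((Set.Ioi (0 : ℝ)).indicator (fun _ => 1) r)) := by
  by_cases hr : 0 < r
  · rw [Set.indicator_of_mem (Set.mem_Ioi.2 hr)]
    refine tendsto_const_nhds.congr' ?_
    obtain ⟨N, hN⟩ := exists_nat_ge (1 / r)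
    filter_upwards [Filter.eventually_ge_atTop N] with n hn
    have h1 : 1 ≤ (n : ℝ) * r := by
      rw [← div_le_iff₀ hr]
      exact hN.trans (by exact_mod_cast hn)
    rw [unitClamp, max_eq_left (by linarith), min_eq_right h1]
  · rw [Set.indicator_of_notMem (by simpa using hr)]
    refine tendsto_const_nhds.congr fun n => ?_
    exact (unitClamp_of_nonpos (mul_nonpos_of_nonneg_of_nonpos n.cast_nonneg (not_lt.1 hr))).symm

theorem nullMeasurableSet_superlevel {u : X → ℝ} (hu : AEMeasurable u ν) (t : ℝ) :
    NullMeasurableSet (superlevel t u) ν :=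
  hu.nullMeasurable measurableSet_Ioi

variable [IsMarkovKernel m] [IsProbabilityMeasure ν]

theorem memLp_unitClamp {u : X → ℝ} (hu : AEMeasurable u ν) :
    MemLp (fun x => unitClamp (u x)) 2 ν := by
  refine MemLp.of_bound (measurable_unitClamp.comp_aemeasurable hu).aestronglyMeasurable 1 ?_
  filter_upwards with x
  rw [Real.norm_eq_abs, abs_of_nonneg (unitClamp_nonneg _)]
  exact unitClamp_le_one _

theorem const_mul_mem_energySubdifferential (hinv : m.Invariant ν) {u v : X → ℝ} {c : ℝ}
    (hc : 0 ≤ c) (h : v ∈ energySubdifferential m ν u) :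
    v ∈ energySubdifferential m ν (fun x => c * u x) := by
  rw [mem_energySubdifferential_iff hinv] at h ⊢
  obtain ⟨hu, hv, H, h0, heq⟩ := h
  simp_rw [mul_left_comm _ c, integral_const_mul]
  refine ⟨hu.const_mul c, hv, H, mul_nonneg hc h0, ?_⟩
  rw [totalVariation_const_mul hinv hu.aestronglyMeasurable.aemeasurable, heq, abs_of_nonneg hc,
    ENNReal.ofReal_mul hc]

theorem integral_eq_zero_of_mem_energySubdifferential (hinv : m.Invariant ν) {u v : X → ℝ}
    (h : v ∈ energySubdifferential m ν u) : ∫ x, v x ∂ν = 0 := by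
  obtain ⟨-, -, H, -, -⟩ := (mem_energySubdifferential_iff hinv).1 h
  have h1 := H (fun _ => 1) (memLp_const 1)
  have h2 := H (fun _ => -1) (memLp_const (-1))
  simp only [totalVariation_const, nonpos_iff_eq_zero, ENNReal.ofReal_eq_zero, mul_one, mul_neg,
    integral_neg] at h1 h2
  linarith

/-- The inequalities `∫ v w ≤ TV(w)` for the clamp and for the remainder add up to an equality at
`u`, so each is an equality. -/
theorem totalVariation_unitClamp_eq (hinv : m.Invariant ν) {u v : X → ℝ}
    (h : v ∈ energySubdifferential m ν u) :
    totalVariation m ν (fun x => unitClamp (u x))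
      = ENNReal.ofReal (∫ x, v x * unitClamp (u x) ∂ν) := by
  obtain ⟨hu, hv, H, h0, heq⟩ := (mem_energySubdifferential_iff hinv).1 h
  have hum := hu.aestronglyMeasurable.aemeasurable
  have hT := memLp_unitClamp hum
  have hR : MemLp (fun x => u x - unitClamp (u x)) 2 ν := hu.sub hT
  have hadd : totalVariation m ν u = _ := totalVariation_eq_add hinv
    hT.aestronglyMeasurable.aemeasurable hR.aestronglyMeasurable.aemeasurable hum
    fun x y => abs_sub_eq_unitClamp_add (u x) (u y)
  have hint : ∫ x, v x * u x ∂ν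
      = ∫ x, v x * unitClamp (u x) ∂ν + ∫ x, v x * (u x - unitClamp (u x)) ∂ν := by
    refine Eq.trans ?_ (integral_add (hv.integrable_mul hT) (hv.integrable_mul hR))
    congr 1 with x
    change v x * u x = v x * unitClamp (u x) + v x * (u x - unitClamp (u x))
    ring
  refine le_antisymm ?_ (H _ hT)
  have hRle := H _ hR
  have hle : totalVariation m ν (fun x => unitClamp (u x))
        + totalVariation m ν (fun x => u x - unitClamp (u x))
      ≤ ENNReal.ofReal (∫ x, v x * unitClamp (u x) ∂ν)
        + totalVariation m ν (fun x => u x - unitClamp (u x)) := by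
    rw [← hadd, heq, hint]
    exact ENNReal.ofReal_add_le.trans (by gcongr)
  -- Cancellation needs the remainder to have finite variation, which `TV(u) < ∞` bounds.
  refine (ENNReal.add_le_add_iff_right ?_).1 hle
  refine ne_top_of_le_ne_top ?_ (le_add_self.trans_eq hadd.symm)
  simp [heq]

/-- If a subgradient at `u` equals the constant `c` on `{u > 0}` and is at most `c` elsewhere, it
is also a subgradient at the characteristic function of `{u > 0}`. -/
theorem mem_energySubdifferential_indicator (hinv : m.Invariant ν) {u v : X → ℝ} {c : ℝ}
    (hc : 0 ≤ c) (h : v ∈ energySubdifferential m ν u) (hvc : ∀ x, 0 < u x → v x = c) :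
    v ∈ energySubdifferential m ν ((superlevel 0 u).indicator fun _ => 1) ∧
      ∫ x, v x * (superlevel 0 u).indicator (fun _ => 1) x ∂ν = c * ν.real (superlevel 0 u) := by
  obtain ⟨hu, hv, H, -, -⟩ := (mem_energySubdifferential_iff hinv).1 h
  have hum := hu.aestronglyMeasurable.aemeasurable
  have hE : NullMeasurableSet (superlevel 0 u) ν := nullMeasurableSet_superlevel hum 0
  have hind : MemLp ((superlevel 0 u).indicator fun _ => (1 : ℝ)) 2 ν := by
    refine MemLp.of_bound (C := 1) (aestronglyMeasurable_const.indicator₀ hE) ?_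
    filter_upwards with x
    by_cases hx : x ∈ superlevel 0 u <;> simp [hx]
  have hint : ∫ x, v x * (superlevel 0 u).indicator (fun _ => 1) x ∂ν
      = c * ν.real (superlevel 0 u) := by
    have : ∀ x, v x * (superlevel 0 u).indicator (fun _ => (1 : ℝ)) x
        = (superlevel 0 u).indicator (fun _ => c) x := by
      intro x
      by_cases hx : x ∈ superlevel 0 u
      · simp [hx, hvc x hx]
      · simp [hx]
    simp_rw [this]
    rw [integral_indicator₀ hE]
    simp [mul_comm]
  refine ⟨(mem_energySubdifferential_iff hinv).2 ⟨hind, hv, H, ?_, le_antisymm ?_ (H _ hind)⟩, hint⟩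
  · rw [hint]
    positivity
  refine totalVariation_le_of_tendsto hinv (f := fun n x => unitClamp (n * u x))
    (fun n => measurable_unitClamp.comp_aemeasurable (hum.const_mul _))
    hind.aestronglyMeasurable.aemeasurable (fun x => tendsto_unitClamp_nat_mul (u x)) fun n => ?_
  -- By homogeneity the same `v` is a subgradient at `n u`, so the truncation identity applies to
  -- every approximant.
  have hn := const_mul_mem_energySubdifferential hinv n.cast_nonneg h
  rw [totalVariation_unitClamp_eq hinv hn]
  refine ENNReal.ofReal_le_ofReal (integral_mono
    (hv.integrable_mul (memLp_unitClamp (hum.const_mul _))) (hv.integrable_mul hind) fun x => ?_)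
  dsimp only
  by_cases hx : x ∈ superlevel 0 u
  · rw [Set.indicator_of_mem hx, hvc x hx]
    exact mul_le_mul_of_nonneg_left (unitClamp_le_one _) hc
  -- Off `{u > 0}` the clamp and the indicator both vanish, so the size of `v` there plays no role.
  · have hux : u x ≤ 0 := not_lt.1 hx
    rw [Set.indicator_of_notMem hx,
      unitClamp_of_nonpos (mul_nonpos_of_nonneg_of_nonpos n.cast_nonneg hux)]

/-- The median property of the eigenvectors with positive eigenvalue. -/
theorem measure_superlevel_le_half (hinv : m.Invariant ν) {u ξ : X → ℝ} {lam : ℝ} (hlam : 0 < lam)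
    (hξ : ∀ x, ξ x ∈ multiSign (u x)) (h : lam • ξ ∈ energySubdifferential m ν u) :
    ν (superlevel 0 u) ≤ 1 / 2 := by
  obtain ⟨hu, hv, -⟩ := (mem_energySubdifferential_iff hinv).1 h
  have hE : NullMeasurableSet (superlevel 0 u) ν :=
    nullMeasurableSet_superlevel hu.aestronglyMeasurable.aemeasurable 0
  have hξi : Integrable ξ ν := by
    have := (hv.integrable one_le_two).smul lam⁻¹
    rwa [smul_smul, inv_mul_cancel₀ hlam.ne', one_smul] at this
  have h0 : ∫ x, ξ x ∂ν = 0 := by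
    have := integral_eq_zero_of_mem_energySubdifferential hinv h
    simp only [Pi.smul_apply, smul_eq_mul, integral_const_mul] at this
    exact (mul_eq_zero.1 this).resolve_left hlam.ne'
  -- Since `ξ = 1` on `E` and `ξ ≥ -1` elsewhere, `2 χ_E - 1 ≤ ξ`; integrating gives `2 ν(E) - 1 ≤
  -- 0`.
  have hle : ∫ x, ((superlevel 0 u).indicator (fun _ => (2 : ℝ)) x - 1) ∂ν ≤ ∫ x, ξ x ∂ν := by
    refine integral_mono (((integrable_const _).indicator₀ hE).sub (integrable_const _)) hξi
      fun x => ?_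
    dsimp only
    by_cases hx : x ∈ superlevel 0 u
    · rw [Set.indicator_of_mem hx, eq_one_of_mem_multiSign hx (hξ x)]
      norm_num
    · rw [Set.indicator_of_notMem hx]
      linarith [(multiSign_subset_Icc _ (hξ x)).1]
  rw [h0, integral_sub ((integrable_const _).indicator₀ hE) (integrable_const _),
    integral_indicator₀ hE] at hle
  simp only [integral_const, smul_eq_mul, measureReal_restrict_apply_univ, mul_one,
    probReal_univ] at hle
  rw [← ofReal_measureReal]
  refine (ENNReal.ofReal_le_ofReal (q := 1 / 2) (by linarith)).trans_eq ?_
  rw [ENNReal.ofReal_div_of_pos two_pos]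
  simp

/-- The same `ξ` serves: it is `1` on the set, and off it the indicator is `0`, where any value in
`[-1, 1]` is a sign. -/
theorem isEigenpair_normalizedIndicator (hinv : m.Invariant ν) {u ξ : X → ℝ} {lam : ℝ}
    (hξ : ∀ x, ξ x ∈ multiSign (u x)) (hE : 0 < ν (superlevel 0 u))
    (h : lam • ξ ∈ energySubdifferential m ν ((superlevel 0 u).indicator fun _ => 1))
    (hEm : NullMeasurableSet (superlevel 0 u) ν) :
    IsEigenpair m ν lam (normalizedIndicator ν (superlevel 0 u)) := by
  have hE' : 0 < ν.real (superlevel 0 u) := ENNReal.toReal_pos hE.ne' (measure_ne_top _ _)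
  have heq : normalizedIndicator ν (superlevel 0 u) = fun x =>
      1 / ν.real (superlevel 0 u) * (superlevel 0 u).indicator (fun _ => 1) x := by
    ext x
    by_cases hx : x ∈ superlevel 0 u <;> simp [normalizedIndicator, hx]
  have hmem := const_mul_mem_energySubdifferential hinv (c := 1 / ν.real (superlevel 0 u))
    (by positivity) h
  rw [← heq] at hmem
  refine ⟨hmem.1, ?_, ξ, fun x => ?_, ?_⟩
  · rw [normalizedIndicator, eLpNorm_indicator_const₀ hEm one_ne_zero ENNReal.one_ne_top,
      ← ofReal_measureReal (μ := ν) (s := superlevel 0 u), Real.enorm_of_nonneg (by positivity)]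
    simp only [ENNReal.toReal_one, div_one, ENNReal.rpow_one]
    rw [← ENNReal.ofReal_mul (by positivity), one_div_mul_cancel hE'.ne', ENNReal.ofReal_one]
  · by_cases hx : x ∈ superlevel 0 u
    · rw [eq_one_of_mem_multiSign hx (hξ x)]
      simp [multiSign, normalizedIndicator, hx, hE']
    · have : normalizedIndicator ν (superlevel 0 u) x = 0 := by simp [normalizedIndicator, hx]
      rw [this]
      simpa [multiSign] using multiSign_subset_Icc _ (hξ x)
  · simpa [oneLaplacian] using hmem

end Eigenpair

/-! ### Calibrability of the two sides of an optimal cut. -/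

section CheegerCut

variable {X : Type*} [MeasurableSpace X] {m : Kernel X X} {ν : Measure X}
  [IsProbabilityMeasure ν]

theorem measure_compl_ge_half {E : Set X} (hE : NullMeasurableSet E ν) (h : ν E ≤ 1 / 2) :
    1 / 2 ≤ ν Eᶜ := by
  rw [prob_compl_eq_one_sub₀ hE]
  calc (1 : ℝ≥0∞) / 2 = 1 - 1 / 2 := by rw [one_div, ENNReal.one_sub_inv_two]
    _ ≤ 1 - ν E := by gcongr

theorem cheegerConstant_le_perimeterRatio {E : Set X} (hE : NullMeasurableSet E ν)
    (h0 : 0 < ν E) (h : ν E ≤ 1 / 2) : cheegerConstant m ν ≤ perimeterRatio m ν E := by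
  have := cheegerConstant_mul_le_perimeter (m := m) hE
  rw [min_eq_left (h.trans (measure_compl_ge_half hE h))] at this
  exact (ENNReal.le_div_iff_mul_le (.inl h0.ne') (.inl (measure_ne_top _ _))).2 this

variable {Ω : Set X}

theorem isCalibrable_of_cheegerConstant_eq (hΩ : NullMeasurableSet Ω ν) (h0 : 0 < ν Ω)
    (h : ν Ω ≤ 1 / 2) (heq : cheegerConstant m ν = perimeterRatio m ν Ω) :
    IsCalibrable m ν Ω := by
  have h1 : ν Ω < ν Set.univ := by
    rw [measure_univ]
    exact h.trans_lt (by simp)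
  refine (isCalibrable_iff hΩ h0 h1).2 fun E hE hEm hE0 => ?_
  rw [← heq]
  exact cheegerConstant_le_perimeterRatio hEm hE0 ((measure_mono hE).trans h)

/-- A small subset `E` of `Ωᶜ` has ratio at least `h`, which exceeds or equals that of `Ωᶜ`. For a
large one, `Eᶜ` is the smaller side and contains `Ω`, so `P(E) ≥ h ν(Eᶜ) ≥ h ν(Ω) = P(Ω)`, while
`ν(E) ≤ ν(Ωᶜ)`. -/
theorem isCalibrable_compl_of_cheegerConstant_eq [IsMarkovKernel m] (hrev : m.IsReversible ν)
    (hΩ : NullMeasurableSet Ω ν) (h0 : 0 < ν Ω) (h : ν Ω ≤ 1 / 2)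
    (heq : cheegerConstant m ν = perimeterRatio m ν Ω) : IsCalibrable m ν Ωᶜ := by
  have hc := measure_compl_ge_half hΩ h
  have h1 : ν Ωᶜ < ν Set.univ := by
    rw [measure_univ, prob_compl_eq_one_sub₀ hΩ]
    exact ENNReal.sub_lt_self (by simp) (by simp) h0.ne'
  have hpos : 0 < ν Ωᶜ := lt_of_lt_of_le (by simp) hc
  refine (isCalibrable_iff hΩ.compl hpos h1).2 fun E hE hEm hE0 => ?_
  have hP : perimeterRatio m ν Ωᶜ = perimeter m ν Ω / ν Ωᶜ := by
    rw [perimeterRatio, perimeter_compl hrev hΩ]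
  rw [hP]
  rcases le_total (ν E) (1 / 2) with hhalf | hhalf
  · calc perimeter m ν Ω / ν Ωᶜ ≤ perimeter m ν Ω / ν Ω :=
          ENNReal.div_le_div_left (h.trans hc) _
      _ = cheegerConstant m ν := heq.symm
      _ ≤ perimeterRatio m ν E := cheegerConstant_le_perimeterRatio hEm hE0 hhalf
  · have hEc : ν Eᶜ ≤ 1 / 2 := by
      rw [prob_compl_eq_one_sub₀ hEm]
      calc 1 - ν E ≤ 1 - 1 / 2 := by gcongr
        _ = 1 / 2 := by rw [one_div, ENNReal.one_sub_inv_two]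
    have hΩE : ν Ω ≤ ν Eᶜ := measure_mono (Set.subset_compl_comm.1 hE)
    have hle := cheegerConstant_mul_le_perimeter (m := m) hEm
    rw [min_eq_right (hEc.trans hhalf)] at hle
    have hΩP : perimeter m ν Ω ≤ perimeter m ν E := by
      calc perimeter m ν Ω = cheegerConstant m ν * ν Ω := by
            rw [heq, perimeterRatio, ENNReal.div_mul_cancel h0.ne' (measure_ne_top _ _)]
        _ ≤ cheegerConstant m ν * ν Eᶜ := by gcongr
        _ ≤ perimeter m ν E := hle
    exact ENNReal.div_le_div hΩP (measure_mono hE)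

end CheegerCut

end RandomWalk

theorem corollary6p13 {X : Type*} [MetricSpace X] [PolishSpace X] [MeasurableSpace X] [BorelSpace X]
    (m : Kernel X X) [IsMarkovKernel m] (hm : RandomWalk.HasFiniteFirstMoment m)
    (ν : Measure X) [IsProbabilityMeasure ν] (hrev : m.IsReversible ν)
    (hconn : RandomWalk.IsMConnected m ν)
    (hpos : 0 < (RandomWalk.cheegerConstant m ν).toReal)
    (u : X → ℝ)
    (hu : RandomWalk.IsEigenpair m ν (RandomWalk.cheegerConstant m ν).toReal u)
    (hE : 0 < ν (RandomWalk.superlevel 0 u)) :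
    RandomWalk.IsEigenpair m ν (RandomWalk.cheegerConstant m ν).toReal
        (RandomWalk.normalizedIndicator ν (RandomWalk.superlevel 0 u)) ∧
      ν (RandomWalk.superlevel 0 u) ≤ 1 / 2 ∧
      RandomWalk.cheegerConstant m ν =
        RandomWalk.perimeterRatio m ν (RandomWalk.superlevel 0 u) ∧
      RandomWalk.IsCalibrable m ν (RandomWalk.superlevel 0 u) ∧
      RandomWalk.IsCalibrable m ν (RandomWalk.superlevel 0 u)ᶜ ∧
      RandomWalk.IsOptimalCheegerCut m ν (RandomWalk.superlevel 0 u) := by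
  obtain ⟨hu2, -, ξ, hξ, hmem⟩ := hu
  have hinv := hrev.invariant
  have hsub : (RandomWalk.cheegerConstant m ν).toReal • ξ
      ∈ RandomWalk.energySubdifferential m ν u := by
    simpa [RandomWalk.oneLaplacian] using hmem
  have hEm : NullMeasurableSet (RandomWalk.superlevel 0 u) ν :=
    RandomWalk.nullMeasurableSet_superlevel hu2.aestronglyMeasurable.aemeasurable 0
  obtain ⟨hind, hint⟩ := RandomWalk.mem_energySubdifferential_indicator hinv hpos.le hsub
    fun x hx => by simp [RandomWalk.eq_one_of_mem_multiSign hx (hξ x)]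
  have hhalf := RandomWalk.measure_superlevel_le_half hinv hpos hξ hsub
  -- `toReal` sends `∞` to `0`, so positivity of the real eigenvalue excludes an infinite Cheeger
  -- constant.
  have htop : RandomWalk.cheegerConstant m ν ≠ ∞ := fun h => by simp [h] at hpos
  have hper : RandomWalk.perimeter m ν (RandomWalk.superlevel 0 u)
      = RandomWalk.cheegerConstant m ν * ν (RandomWalk.superlevel 0 u) := by
    rw [← RandomWalk.totalVariation_indicator hrev hEm,
      ((RandomWalk.mem_energySubdifferential_iff hinv).1 hind).2.2.2.2, hint,
      ENNReal.ofReal_mul hpos.le, ENNReal.ofReal_toReal htop, ofReal_measureReal]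
  have hratio : RandomWalk.cheegerConstant m ν
      = RandomWalk.perimeterRatio m ν (RandomWalk.superlevel 0 u) := by
    rw [RandomWalk.perimeterRatio, hper, ENNReal.mul_div_cancel_right hE.ne' (measure_ne_top _ _)]
  refine ⟨RandomWalk.isEigenpair_normalizedIndicator hinv hξ hE hind hEm, hhalf, hratio,
    RandomWalk.isCalibrable_of_cheegerConstant_eq hEm hE hhalf hratio,
    RandomWalk.isCalibrable_compl_of_cheegerConstant_eq hrev hEm hE hhalf hratio,
    hEm, hE, hhalf.trans_lt (by simp), ?_⟩
  rw [RandomWalk.cutValue, min_eq_left (hhalf.trans (RandomWalk.measure_compl_ge_half hEm hhalf))]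
  exact hratio
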